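/- Let $W=(W_t)_{t\ge 0}$ be a standard one-dimensional Brownian motion on a probability space and let $T\ge 0$. Then $\exp\bigl(\int_0^T W_t^2\,dt\bigr)$ is an (almost everywhere) measurable nonnegative random variable, and its expectation in $[0,\infty]$ is $$E\exp\Bigl(\int_0^T W_t^2\,dt\Bigr)=\begin{cases}\dfrac{1}{\sqrt{\cos(\sqrt2\,T)}}, & \text{if } T<\dfrac{\pi}{2\sqrt2},\\[2mm] +\infty, & \text{if } T\ge\dfrac{\pi}{2\sqrt2}.\end{cases}$$ -/

import Mathlib

open MeasureTheory ProbabilityTheory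
open scoped NNReal ENNReal

/-!
The expectation is computed from Riemann sums of `t ↦ Wₜ²`. For a sum with step `h`, the increments
are integrated out one at a time from the right: if `ξ` is centered Gaussian with variance `h`,
then `E exp (a (x + ξ)²) = exp (a / (1 - 2 a h) x²) / √(1 - 2 a h)`. The resulting recursion
`a ↦ b + a / (1 - 2 a h)` on coefficients is linear fractional, and it is the discretization of
`y'' = -2 b y / h`. It is solved by writing `1 - 2 a h` as a ratio
`cos ((j + 1/2) θ) / cos ((j - 1/2) θ)`, where `2 h b = 2 - 2 cos θ`. The product of the factors
telescopes and gives `√(cos (θ / 2) / cos ((n - 1/2) θ))` exactly (`lintegral_exp_sum_sq`).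

With `b = x² h / (2 T²)`, `h = T / n` and `0 < x < π / 2`, the angle `n θ` tends to `x`, so these
exponential moments tend to `1 / √(cos x)`. By path continuity the Riemann sums converge almost
surely to the integral. Running the same computation at a slightly larger angle bounds a higher
moment, so the exponentials are uniformly integrable and the limit may be exchanged with the
expectation (`lintegral_exp_eq_of_tendsto`). This yields
`E exp (x² / (2 T²) ∫₀ᵀ Wₜ² dt) = 1 / √(cos x)` (`lintegral_exp_integral_sq`).

The choice `x = √2 T` is the subcritical case. If `√2 T ≥ π / 2`, every `x < π / 2` gives an
exponent `x² / (2 T²) ≤ 1`, so the expectation is at least `1 / √(cos x)`, which is unbounded as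
`x` increases to `π / 2`.
-/

open Filter Topology

section

variable {Ω : Type*} [MeasurableSpace Ω] {P : Measure Ω}

/-! ### Gaussian recursion for discretized paths -/

lemma lintegral_exp_mul_sq_gaussianReal {a : ℝ} {v : ℝ≥0} (hv : v ≠ 0) (ha : 2 * a * v < 1)
    (x : ℝ) :
    ∫⁻ y, ENNReal.ofReal (Real.exp (a * (x + y) ^ 2)) ∂(gaussianReal 0 v) =
      ENNReal.ofReal (1 / √(1 - 2 * a * v) * Real.exp (a / (1 - 2 * a * v) * x ^ 2)) := by
  set r : ℝ := 1 - 2 * a * v with hr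
  have hr0 : 0 < r := by linarith
  have hv0 : (0 : ℝ) < v := by positivity
  set w : ℝ≥0 := v / r.toNNReal with hw
  have hwr : (w : ℝ) = v / r := by simp [hw, hr0.le]
  have hw0 : w ≠ 0 := by
    have : (0 : ℝ) < w := by rw [hwr]; positivity
    exact_mod_cast this.ne'
  rw [gaussianReal_of_var_ne_zero 0 hv,
    lintegral_withDensity_eq_lintegral_mul _ (measurable_gaussianPDF 0 v) (by fun_prop)]
  -- completing the square turns the integrand into a multiple of another Gaussian density
  have key : ∀ y, gaussianPDFReal 0 v y * Real.exp (a * (x + y) ^ 2) =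
      1 / √r * Real.exp (a / r * x ^ 2) * gaussianPDFReal (2 * a * v * x / r) w y := by
    intro y
    simp only [gaussianPDFReal, hwr]
    have e1 : √(2 * Real.pi * (v / r)) = √(2 * Real.pi * v) / √r := by
      rw [← Real.sqrt_div (by positivity)]; ring_nf
    have e2 : -(y - 0) ^ 2 / (2 * v) + a * (x + y) ^ 2 =
        a / r * x ^ 2 + -(y - 2 * a * v * x / r) ^ 2 / (2 * (v / r)) := by
      field_simp
      rw [hr]; ring
    have : 0 < √r := Real.sqrt_pos.2 hr0
    rw [e1, mul_assoc, ← Real.exp_add, e2, Real.exp_add]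
    field_simp
  calc ∫⁻ y, (gaussianPDF 0 v * fun y => ENNReal.ofReal (Real.exp (a * (x + y) ^ 2))) y
      = ∫⁻ y, ENNReal.ofReal (1 / √r * Real.exp (a / r * x ^ 2)) *
          gaussianPDF (2 * a * v * x / r) w y := by
        refine lintegral_congr fun y => ?_
        simp only [Pi.mul_apply, gaussianPDF]
        rw [← ENNReal.ofReal_mul (gaussianPDFReal_nonneg _ _ _), key,
          ENNReal.ofReal_mul (by positivity)]
    _ = _ := by
        rw [lintegral_const_mul _ (measurable_gaussianPDF _ _),
          lintegral_gaussianPDF_eq_one _ hw0, mul_one]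

/-- Integrating out a centered Gaussian increment `ξ` replaces the coefficient `a` of the last
square by `a / (1 - 2 a v)`. -/
lemma lintegral_exp_add_mul_sq_of_indepFun [IsProbabilityMeasure P] {Z X ξ : Ω → ℝ} {v : ℝ≥0}
    {a : ℝ} (hZ : AEMeasurable Z P) (hX : AEMeasurable X P) (hξ : HasLaw ξ (gaussianReal 0 v) P)
    (hind : IndepFun (fun ω => (Z ω, X ω)) ξ P) (hv : v ≠ 0) (ha : 2 * a * v < 1) :
    ∫⁻ ω, ENNReal.ofReal (Real.exp (Z ω + a * (X ω + ξ ω) ^ 2)) ∂P =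
      ENNReal.ofReal (1 / √(1 - 2 * a * v)) *
        ∫⁻ ω, ENNReal.ofReal (Real.exp (Z ω + a / (1 - 2 * a * v) * X ω ^ 2)) ∂P := by
  have hZX : AEMeasurable (fun ω => (Z ω, X ω)) P := hZ.prodMk hX
  have hmap := (indepFun_iff_map_prod_eq_prod_map_map hZX hξ.aemeasurable).1 hind
  rw [hξ.map_eq] at hmap
  have := Measure.isProbabilityMeasure_map hZX (μ := P)
  calc ∫⁻ ω, ENNReal.ofReal (Real.exp (Z ω + a * (X ω + ξ ω) ^ 2)) ∂P
      = ∫⁻ q, ENNReal.ofReal (Real.exp (q.1.1 + a * (q.1.2 + q.2) ^ 2))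
          ∂(P.map fun ω => ((Z ω, X ω), ξ ω)) := by
        rw [lintegral_map' (Measurable.aemeasurable (by fun_prop)) (hZX.prodMk hξ.aemeasurable)]
    _ = ∫⁻ p, ENNReal.ofReal (1 / √(1 - 2 * a * v)) *
          ENNReal.ofReal (Real.exp (p.1 + a / (1 - 2 * a * v) * p.2 ^ 2))
          ∂(P.map fun ω => (Z ω, X ω)) := by
        rw [hmap, lintegral_prod _ (Measurable.aemeasurable (by fun_prop))]
        refine lintegral_congr fun p => ?_
        simp_rw [Real.exp_add, ENNReal.ofReal_mul (Real.exp_nonneg _)]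
        rw [lintegral_const_mul _ (by fun_prop), lintegral_exp_mul_sq_gaussianReal hv ha,
          ENNReal.ofReal_mul (by positivity)]
        ring
    _ = _ := by
        rw [lintegral_const_mul _ (by fun_prop),
          lintegral_map' (Measurable.aemeasurable (by fun_prop)) hZX]

/-- Conditioning on the path up to time `n h` removes the last of the sampling times. -/
lemma lintegral_exp_sum_sq_step [IsProbabilityMeasure P] {W : ℝ≥0 → Ω → ℝ}
    (hW : IsPreBrownianReal W P) {h : ℝ≥0} (hh : h ≠ 0) {a b : ℝ} (ha : 2 * a * h < 1) (n : ℕ) :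
    ∫⁻ ω, ENNReal.ofReal (Real.exp
        (b * ∑ k ∈ Finset.range (n + 1), W (k * h) ω ^ 2 + a * W ((n + 1 : ℕ) * h) ω ^ 2)) ∂P =
      ENNReal.ofReal (1 / √(1 - 2 * a * h)) *
        ∫⁻ ω, ENNReal.ofReal (Real.exp (b * ∑ k ∈ Finset.range n, W (k * h) ω ^ 2 +
          (b + a / (1 - 2 * a * h)) * W (n * h) ω ^ 2)) ∂P := by
  set t₀ : ℝ≥0 := n * h with ht₀
  have hmeas : ∀ t, AEMeasurable (W t) P := hW.aemeasurable
  have hlaw : HasLaw (fun ω => W (t₀ + h) ω - W t₀ ω) (gaussianReal 0 h) P :=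
    (hW.shift t₀).hasLaw_eval h
  have hle : ∀ k : Finset.range (n + 1), (k : ℕ) * h ≤ t₀ := fun k => by
    have : ((k : ℕ) : ℝ≥0) ≤ n := by
      exact_mod_cast Nat.lt_succ_iff.1 (Finset.mem_range.1 k.2)
    exact mul_le_mul_left this h
  have hind : IndepFun (fun ω => (b * ∑ k ∈ Finset.range (n + 1), W (k * h) ω ^ 2, W t₀ ω))
      (fun ω => W (t₀ + h) ω - W t₀ ω) P := by
    have hev : ∀ s : Set.Iic t₀, Measurable fun w : Set.Iic t₀ → ℝ => w s :=
      measurable_pi_apply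
    have := (hW.indepFun_shift t₀).symm.comp
      (φ := fun w : Set.Iic t₀ → ℝ => (b * ∑ k : Finset.range (n + 1),
        w ⟨(k : ℕ) * h, hle k⟩ ^ 2, w ⟨t₀, Set.self_mem_Iic⟩))
      (ψ := fun w : ℝ≥0 → ℝ => w h)
      (((Finset.measurable_fun_sum _ fun k _ =>
        (hev _).pow_const 2).const_mul b).prodMk (hev _))
      (measurable_pi_apply (X := fun _ : ℝ≥0 => ℝ) h)
    convert this using 2 with ω
    · simp only [Function.comp]
      rw [Finset.sum_coe_sort (Finset.range (n + 1)) (fun k => W ((k : ℕ) * h) ω ^ 2)]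
    · rfl
  have hstep := lintegral_exp_add_mul_sq_of_indepFun (a := a) (by fun_prop) (hmeas t₀) hlaw hind
    hh ha
  have e1 : ((n + 1 : ℕ) : ℝ≥0) * h = t₀ + h := by rw [ht₀]; push_cast; ring
  rw [e1]
  convert hstep using 6 with ω ω
  · ring
  · rw [Finset.sum_range_succ, ← ht₀]
    ring

/-- Exact evaluation of the discretized functional with a terminal weight on the last square. With
`b` and the weight expressed through the angle `θ`, the map `a ↦ b + a / (1 - 2 a h)` of
`lintegral_exp_sum_sq_step` becomes the shift `j ↦ j + 1`, and the product of the factors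
`1 / √(1 - 2 a h)` telescopes. -/
lemma lintegral_exp_sum_sq [IsProbabilityMeasure P] {W : ℝ≥0 → Ω → ℝ}
    (hW : IsPreBrownianReal W P) {h : ℝ≥0} (hh : h ≠ 0) {b θ : ℝ} (hθ0 : 0 ≤ θ)
    (hb : 2 * h * b = 2 - 2 * Real.cos θ) (n : ℕ) : ∀ j : ℕ, θ < Real.pi →
    (n + j - 1 / 2) * θ < Real.pi / 2 →
    ∫⁻ ω, ENNReal.ofReal (Real.exp (b * ∑ k ∈ Finset.range n, W (k * h) ω ^ 2 +
        (1 - Real.cos ((j + 1 / 2) * θ) / Real.cos ((j - 1 / 2) * θ)) / (2 * h)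
          * W (n * h) ω ^ 2)) ∂P =
      ENNReal.ofReal
        (√(Real.cos ((j - 1 / 2) * θ) / Real.cos ((n + j - 1 / 2) * θ))) := by
  have hcos : ∀ m : ℝ, -1 / 2 ≤ m → θ < Real.pi → m * θ < Real.pi / 2 →
      0 < Real.cos (m * θ) := fun m hm h1 h2 =>
    Real.cos_pos_of_mem_Ioo ⟨by nlinarith, h2⟩
  induction n with
  | zero =>
    intro j hpi hlt
    have h0 := hW.eval_zero_ae_eq_zero
    have hc := hcos (j - 1 / 2) (by have : (0 : ℝ) ≤ j := by positivity
                                    linarith) hpi (by simpa using hlt)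
    have : ∀ᵐ ω ∂P, ENNReal.ofReal (Real.exp (b * ∑ k ∈ Finset.range 0, W (k * h) ω ^ 2 +
        (1 - Real.cos ((j + 1 / 2) * θ) / Real.cos ((j - 1 / 2) * θ)) / (2 * h)
          * W ((0 : ℕ) * h) ω ^ 2)) = 1 := by
      filter_upwards [h0] with ω hω
      simp [hω]
    rw [lintegral_congr_ae this]
    rw [Nat.cast_zero, zero_add, div_self hc.ne']
    simp
  | succ n ih =>
    intro j hpi hlt
    have hj : (0 : ℝ) ≤ j := by positivity
    have hn : (0 : ℝ) ≤ n := by positivity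
    have hh0 : (0 : ℝ) < h := by positivity
    push_cast at hlt
    have c0 := hcos (j - 1 / 2) (by linarith) hpi (by nlinarith)
    have c1 := hcos (j + 1 / 2) (by linarith) hpi (by nlinarith)
    have c2 := hcos (n + 1 + j - 1 / 2) (by linarith) hpi hlt
    set C0 := Real.cos ((j - 1 / 2) * θ)
    set C1 := Real.cos ((j + 1 / 2) * θ)
    have e : 1 - 2 * ((1 - C1 / C0) / (2 * h)) * h = C1 / C0 := by field_simp; ring
    have ha : 2 * ((1 - C1 / C0) / (2 * h)) * h < 1 := by
      have : 0 < C1 / C0 := by positivity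
      linarith
    rw [lintegral_exp_sum_sq_step hW hh ha, e]
    have ih' := ih (j + 1) hpi (by push_cast; linarith)
    push_cast at ih'
    have i1 : (j : ℝ) + 1 - 1 / 2 = j + 1 / 2 := by ring
    have i2 : (n : ℝ) + (j + 1) - 1 / 2 = n + 1 + j - 1 / 2 := by ring
    rw [i1, i2] at ih'
    -- the three-term recurrence `cos (α + θ) + cos (α - θ) = 2 cos α cos θ`
    have hrec : Real.cos ((j + 1 + 1 / 2) * θ) = 2 * C1 * Real.cos θ - C0 := by
      have s1 : (j + 1 + 1 / 2) * θ = (j + 1 / 2) * θ + θ := by ring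
      have s2 : (j - 1 / 2) * θ = (j + 1 / 2) * θ - θ := by ring
      simp only [C0, C1]
      rw [s1, s2, Real.cos_add, Real.cos_sub]; ring
    have ea : b + (1 - C1 / C0) / (2 * h) / (C1 / C0) =
        (1 - Real.cos ((j + 1 + 1 / 2) * θ) / C1) / (2 * h) := by
      rw [hrec]
      have hb' : b = (2 - 2 * Real.cos θ) / (2 * h) := by rw [← hb]; field_simp
      rw [hb']
      field_simp
      ring
    push_cast
    rw [ea, ih', ← ENNReal.ofReal_mul (by positivity)]
    congr 1
    rw [one_div, ← Real.sqrt_inv, ← Real.sqrt_mul (by positivity)]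
    congr 1
    rw [inv_div, div_mul_div_cancel₀ c1.ne']

/-! ### Limits of Riemann sums and of exponential moments -/

lemma tendsto_riemann_sum {g : ℝ → ℝ} (hg : Continuous g) {T : ℝ} (hT : 0 ≤ T) :
    Tendsto (fun n : ℕ => T / n * ∑ k ∈ Finset.range n, g (k * (T / n))) atTop
      (𝓝 (∫ t in (0 : ℝ)..T, g t)) := by
  rw [Metric.tendsto_nhds]
  intro ε hε
  have hε' : 0 < ε / (T + 1) := by positivity
  obtain ⟨δ, hδ, hu⟩ := Metric.uniformContinuousOn_iff.1
    (isCompact_Icc.uniformContinuousOn_of_continuous (hg.continuousOn (s := Set.Icc 0 T)))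
    _ hε'
  filter_upwards [(tendsto_const_div_atTop_nhds_zero_nat T).eventually_lt_const hδ,
    eventually_gt_atTop 0] with n hn hn0
  have hn0' : (0 : ℝ) < n := by exact_mod_cast hn0
  set h := T / n with hh
  have hh0 : 0 ≤ h := by positivity
  have hnh : n * h = T := by rw [hh]; field_simp
  have hsum : ∫ t in (0 : ℝ)..T, g t =
      ∑ k ∈ Finset.range n, ∫ t in (k * h)..((k + 1 : ℕ) * h), g t := by
    rw [intervalIntegral.sum_integral_adjacent_intervals
      (f := g) (a := fun k : ℕ => (k : ℝ) * h) fun k _ => hg.intervalIntegrable _ _, hnh]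
    simp
  have hbound : ∀ k ∈ Finset.range n,
      ‖h * g (k * h) - ∫ t in (k * h)..((k + 1 : ℕ) * h), g t‖ ≤ ε / (T + 1) * h := by
    intro k hk
    have hk1 : ((k + 1 : ℕ) : ℝ) ≤ n := by exact_mod_cast Finset.mem_range.1 hk
    have hlen : ((k + 1 : ℕ) : ℝ) * h - k * h = h := by push_cast; ring
    have hconst : h * g (k * h) = ∫ _ in (k * h)..((k + 1 : ℕ) * h), g (k * h) := by
      rw [intervalIntegral.integral_const, hlen, smul_eq_mul]
    rw [hconst, ← intervalIntegral.integral_sub (by simp) (hg.intervalIntegrable _ _)]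
    refine (intervalIntegral.norm_integral_le_of_norm_le_const (C := ε / (T + 1)) ?_).trans ?_
    · intro t ht
      rw [Set.uIoc_of_le (by linarith)] at ht
      have hkn : ((k + 1 : ℕ) : ℝ) * h ≤ T := by rw [← hnh]; gcongr
      have hk0 : (0 : ℝ) ≤ k * h := by positivity
      have := hu (k * h) ⟨hk0, by linarith⟩ t ⟨by linarith [ht.1], by linarith [ht.2]⟩
        (by rw [Real.dist_eq, abs_lt]; constructor <;> linarith [ht.1, ht.2])
      rw [← dist_eq_norm]
      exact this.le
    · rw [hlen, abs_of_nonneg hh0]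
  rw [Real.dist_eq, hsum, Finset.mul_sum, ← Finset.sum_sub_distrib]
  calc ‖∑ k ∈ Finset.range n, (h * g (k * h) - ∫ t in (k * h)..((k + 1 : ℕ) * h), g t)‖
      ≤ ∑ k ∈ Finset.range n, ε / (T + 1) * h := norm_sum_le_of_le _ hbound
    _ = ε / (T + 1) * T := by
        rw [Finset.sum_const, Finset.card_range, nsmul_eq_mul, ← hnh]; ring
    _ < ε := by
        rw [div_mul_eq_mul_div, div_lt_iff₀ (by positivity)]
        linarith

/-- Passing to the limit in exponential moments when some higher moments are bounded, which is
what makes the exponentials uniformly integrable. -/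
lemma lintegral_exp_eq_of_tendsto [IsFiniteMeasure P] {S : ℕ → Ω → ℝ} {Y : Ω → ℝ}
    (hS : ∀ n, AEMeasurable (S n) P)
    (hlim : ∀ᵐ ω ∂P, Tendsto (fun n => S n ω) atTop (𝓝 (Y ω))) {L C : ℝ≥0∞}
    (hL : Tendsto (fun n => ∫⁻ ω, ENNReal.ofReal (Real.exp (S n ω)) ∂P) atTop (𝓝 L))
    {q : ℝ} (hq : 1 < q) (hC : C ≠ ⊤)
    (hbdd : ∀ᶠ n in atTop, ∫⁻ ω, ENNReal.ofReal (Real.exp (q * S n ω)) ∂P ≤ C) :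
    ∫⁻ ω, ENNReal.ofReal (Real.exp (Y ω)) ∂P = L := by
  apply le_antisymm
  · calc ∫⁻ ω, ENNReal.ofReal (Real.exp (Y ω)) ∂P
        = ∫⁻ ω, liminf (fun n => ENNReal.ofReal (Real.exp (S n ω))) atTop ∂P := by
          refine lintegral_congr_ae ?_
          filter_upwards [hlim] with ω hω
          exact ((ENNReal.tendsto_ofReal
            ((Real.continuous_exp.tendsto _).comp hω)).liminf_eq).symm
      _ ≤ liminf (fun n => ∫⁻ ω, ENNReal.ofReal (Real.exp (S n ω)) ∂P) atTop :=
          lintegral_liminf_le' fun n => (hS n).exp.ennreal_ofReal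
      _ = L := hL.liminf_eq
  · have htrunc : ∀ M : ℝ, L ≤ ∫⁻ ω, ENNReal.ofReal (Real.exp (Y ω)) ∂P +
        ENNReal.ofReal (Real.exp (-((q - 1) * M))) * C := by
      intro M
      -- above the level `M` the exponential is controlled by its `q`-th power
      have hpt : ∀ s : ℝ, ENNReal.ofReal (Real.exp s) ≤ ENNReal.ofReal (Real.exp (min s M)) +
          ENNReal.ofReal (Real.exp (-((q - 1) * M))) * ENNReal.ofReal (Real.exp (q * s)) := by
        intro s
        rcases le_total s M with hs | hs
        · rw [min_eq_left hs]; exact le_self_add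
        · refine le_add_left ?_
          rw [← ENNReal.ofReal_mul (Real.exp_nonneg _), ← Real.exp_add]
          exact ENNReal.ofReal_le_ofReal (Real.exp_le_exp.2 (by nlinarith))
      have hmin : Tendsto (fun n => ∫⁻ ω, ENNReal.ofReal (Real.exp (min (S n ω) M)) ∂P) atTop
          (𝓝 (∫⁻ ω, ENNReal.ofReal (Real.exp (min (Y ω) M)) ∂P)) := by
        refine tendsto_lintegral_of_dominated_convergence' (fun _ => ENNReal.ofReal (Real.exp M))
          (fun n => ((hS n).min aemeasurable_const).exp.ennreal_ofReal) (fun n => ?_) ?_ ?_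
        · exact .of_forall fun ω => ENNReal.ofReal_le_ofReal
            (Real.exp_le_exp.2 (min_le_right _ _))
        · rw [lintegral_const]
          exact ENNReal.mul_ne_top ENNReal.ofReal_ne_top (measure_ne_top _ _)
        · filter_upwards [hlim] with ω hω
          exact ENNReal.tendsto_ofReal
            ((Real.continuous_exp.tendsto _).comp (hω.min tendsto_const_nhds))
      refine (le_of_tendsto_of_tendsto hL (hmin.add tendsto_const_nhds) ?_).trans
        (add_le_add_left (lintegral_mono fun ω => ENNReal.ofReal_le_ofReal
            (Real.exp_le_exp.2 (min_le_left _ M))) _)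
      filter_upwards [hbdd] with n hn
      calc ∫⁻ ω, ENNReal.ofReal (Real.exp (S n ω)) ∂P
          ≤ ∫⁻ ω, (ENNReal.ofReal (Real.exp (min (S n ω) M)) +
            ENNReal.ofReal (Real.exp (-((q - 1) * M))) *
              ENNReal.ofReal (Real.exp (q * S n ω))) ∂P := lintegral_mono fun ω => hpt _
        _ = ∫⁻ ω, ENNReal.ofReal (Real.exp (min (S n ω) M)) ∂P +
            ENNReal.ofReal (Real.exp (-((q - 1) * M))) *
              ∫⁻ ω, ENNReal.ofReal (Real.exp (q * S n ω)) ∂P := by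
            rw [lintegral_add_left' ((hS n).min aemeasurable_const).exp.ennreal_ofReal,
              lintegral_const_mul'' _ ((hS n).const_mul q).exp.ennreal_ofReal]
        _ ≤ _ := by gcongr
    have h0 : Tendsto (fun M : ℝ => ENNReal.ofReal (Real.exp (-((q - 1) * M)))) atTop (𝓝 0) := by
      rw [← ENNReal.ofReal_zero]
      exact ENNReal.tendsto_ofReal (Real.tendsto_exp_neg_atTop_nhds_zero.comp
        (tendsto_id.const_mul_atTop (by linarith)))
    have hfin := (ENNReal.Tendsto.mul_const h0 (Or.inr hC)).const_add
      (∫⁻ ω, ENNReal.ofReal (Real.exp (Y ω)) ∂P)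
    rw [zero_mul, add_zero] at hfin
    exact ge_of_tendsto' hfin htrunc

lemma tendsto_nat_mul_two_mul_arcsin {x : ℝ} (hx : x ≠ 0) :
    Tendsto (fun n : ℕ => (n : ℝ) * (2 * Real.arcsin (x / 2 / n))) atTop (𝓝 x) := by
  have h1 : HasDerivAt Real.arcsin 1 0 := by
    simpa using Real.hasDerivAt_arcsin (x := 0) (by norm_num) (by norm_num)
  have h2 : Tendsto (fun n : ℕ => x / 2 / n) atTop (𝓝[≠] 0) := by
    refine tendsto_nhdsWithin_iff.2 ⟨tendsto_const_div_atTop_nhds_zero_nat _, ?_⟩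
    filter_upwards [eventually_gt_atTop 0] with n hn
    have : (n : ℝ) ≠ 0 := by exact_mod_cast hn.ne'
    simp [hx, this]
  have h3 := (h1.tendsto_slope_zero.comp h2).const_mul x
  rw [mul_one] at h3
  refine h3.congr' ?_
  filter_upwards [eventually_gt_atTop 0] with n hn
  have : (n : ℝ) ≠ 0 := by exact_mod_cast hn.ne'
  simp
  field_simp

/-! ### Exponential moments of the integrated square -/

/-- The left-endpoint Riemann sum, with `n` steps of length `T / n`, of the square of the path
`t ↦ W t ω` over `[0, T]`. -/
noncomputable def riemannSumSq (W : ℝ≥0 → Ω → ℝ) (T : ℝ) (n : ℕ) (ω : Ω) : ℝ :=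
  T / n * ∑ k ∈ Finset.range n, W (k * (T / n).toNNReal) ω ^ 2

lemma aemeasurable_riemannSumSq {W : ℝ≥0 → Ω → ℝ} (hW : IsPreBrownianReal W P) (T : ℝ) (n : ℕ) :
    AEMeasurable (riemannSumSq W T n) P := by
  have := hW.aemeasurable
  unfold riemannSumSq
  fun_prop

lemma ae_tendsto_riemannSumSq {W : ℝ≥0 → Ω → ℝ} (hW : IsBrownianReal W P) {T : ℝ} (hT : 0 ≤ T) :
    ∀ᵐ ω ∂P, Tendsto (fun n => riemannSumSq W T n ω) atTop
      (𝓝 (∫ t in (0 : ℝ)..T, W t.toNNReal ω ^ 2)) := by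
  filter_upwards [hW.cont] with ω hω
  have hg : Continuous fun t : ℝ => W t.toNNReal ω ^ 2 :=
    (hω.comp continuous_real_toNNReal).pow 2
  refine (tendsto_riemann_sum hg hT).congr fun n => ?_
  simp only [riemannSumSq]
  congr 1
  refine Finset.sum_congr rfl fun k _ => ?_
  rw [Real.toNNReal_mul (by positivity), Real.toNNReal_natCast]

/-- The coefficient is such that the step angle `θ` of `lintegral_exp_sum_sq`, which satisfies
`2 - 2 cos θ = (x / n) ^ 2`, is `2 arcsin (x / (2 n))`; hence `n θ → x`. -/
lemma tendsto_lintegral_exp_riemannSumSq [IsProbabilityMeasure P] {W : ℝ≥0 → Ω → ℝ}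
    (hW : IsPreBrownianReal W P) {T : ℝ} (hT : 0 < T) {x : ℝ} (hx0 : 0 < x)
    (hx : x < Real.pi / 2) :
    Tendsto (fun n => ∫⁻ ω, ENNReal.ofReal
        (Real.exp (x ^ 2 / (2 * T ^ 2) * riemannSumSq W T n ω)) ∂P) atTop
      (𝓝 (ENNReal.ofReal (1 / √(Real.cos x)))) := by
  set θ : ℕ → ℝ := fun n => 2 * Real.arcsin (x / 2 / n) with hθ
  have hnθ : Tendsto (fun n : ℕ => (n : ℝ) * θ n) atTop (𝓝 x) :=
    tendsto_nat_mul_two_mul_arcsin hx0.ne'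
  have hdiv : Tendsto (fun n : ℕ => x / 2 / (n : ℝ)) atTop (𝓝 0) :=
    tendsto_const_div_atTop_nhds_zero_nat _
  have hθ0 : Tendsto θ atTop (𝓝 0) := by
    simpa using ((Real.continuous_arcsin.tendsto 0).comp hdiv).const_mul 2
  have hend : Tendsto (fun n : ℕ => ((n : ℝ) - 1 / 2) * θ n) atTop (𝓝 x) := by
    have := hnθ.sub (hθ0.const_mul (1 / 2))
    rw [mul_zero, sub_zero] at this
    exact this.congr fun n => by ring
  have hcosx : 0 < Real.cos x := Real.cos_pos_of_mem_Ioo ⟨by linarith, hx⟩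
  have hlim : Tendsto (fun n : ℕ => ENNReal.ofReal
      √(Real.cos ((-1 / 2) * θ n) / Real.cos ((n - 1 / 2) * θ n))) atTop
      (𝓝 (ENNReal.ofReal (1 / √(Real.cos x)))) := by
    have hnum := (Real.continuous_cos.tendsto _).comp (hθ0.const_mul (-1 / 2))
    rw [mul_zero, Real.cos_zero] at hnum
    have := (hnum.div ((Real.continuous_cos.tendsto _).comp hend) hcosx.ne').sqrt
    rw [Real.sqrt_div zero_le_one, Real.sqrt_one] at this
    exact ENNReal.tendsto_ofReal this
  refine hlim.congr' ?_
  filter_upwards [eventually_gt_atTop 0, hend.eventually_lt_const hx,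
    hθ0.eventually_lt_const Real.pi_pos, hdiv.eventually_lt_const one_pos] with n hn h1 h2 h3
  have hn' : (0 : ℝ) < n := by exact_mod_cast hn
  have hpos : 0 < x / 2 / n := by positivity
  have hstep : 0 < T / n := by positivity
  have hh : (T / n).toNNReal ≠ 0 := by simpa using hstep
  have hsin : Real.sin (θ n / 2) = x / 2 / n := by
    rw [hθ, mul_div_cancel_left₀ _ two_ne_zero]
    exact Real.sin_arcsin (by linarith) h3.le
  have hb : 2 * ((T / n).toNNReal : ℝ) * (x ^ 2 / (2 * T ^ 2) * (T / n)) =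
      2 - 2 * Real.cos (θ n) := by
    have hc : Real.cos (θ n) = 1 - 2 * (x / 2 / n) ^ 2 := by
      rw [← hsin, ← mul_div_cancel₀ (θ n) (two_ne_zero), Real.cos_two_mul', Real.cos_sq']
      ring_nf
    rw [Real.coe_toNNReal _ hstep.le, hc]
    field_simp
    ring
  have hθn : 0 ≤ θ n := mul_nonneg zero_le_two (Real.arcsin_nonneg.2 hpos.le)
  have key := lintegral_exp_sum_sq hW hh hθn hb n 0 h2 (by simpa using h1)
  have e0 : (((0 : ℕ) : ℝ) - 1 / 2) = -1 / 2 := by norm_num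
  have e1 : (n : ℝ) + ((0 : ℕ) : ℝ) - 1 / 2 = n - 1 / 2 := by simp
  rw [e0, e1] at key
  rw [← key]
  refine lintegral_congr fun ω => ?_
  have hc : Real.cos ((-1 / 2) * θ n) ≠ 0 :=
    (Real.cos_pos_of_mem_Ioo ⟨by linarith, by linarith⟩).ne'
  -- at index `0` the coefficient of the last square vanishes since cosine is even
  have e2 : Real.cos ((((0 : ℕ) : ℝ) + 1 / 2) * θ n) = Real.cos ((-1 / 2) * θ n) := by
    rw [← Real.cos_neg]; congr 1; push_cast; ring
  rw [e2, div_self hc, sub_self, zero_div, zero_mul, add_zero, mul_assoc, riemannSumSq]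

/-- The exponential moments of `∫₀ᵀ Wₜ² dt` below the critical exponent, parametrized by the
angle `x`. -/
theorem lintegral_exp_integral_sq [IsProbabilityMeasure P] {W : ℝ≥0 → Ω → ℝ}
    (hW : IsBrownianReal W P) {T : ℝ} (hT : 0 < T) {x : ℝ} (hx0 : 0 < x)
    (hx : x < Real.pi / 2) :
    ∫⁻ ω, ENNReal.ofReal
        (Real.exp (x ^ 2 / (2 * T ^ 2) * ∫ t in (0 : ℝ)..T, W t.toNNReal ω ^ 2)) ∂P =
      ENNReal.ofReal (1 / √(Real.cos x)) := by
  -- the moments at a larger angle `y` are the higher moments giving uniform integrability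
  obtain ⟨y, hxy, hy⟩ := exists_between hx
  have hpre := hW.toIsPreBrownianReal
  refine lintegral_exp_eq_of_tendsto (q := (y / x) ^ 2)
    (C := ENNReal.ofReal (1 / √(Real.cos y)) + 1)
    (fun n => (aemeasurable_riemannSumSq hpre T n).const_mul _) ?_
    (tendsto_lintegral_exp_riemannSumSq hpre hT hx0 hx) ?_ (by simp) ?_
  · filter_upwards [ae_tendsto_riemannSumSq hW hT.le] with ω hω using hω.const_mul _
  · have : 1 < y / x := (one_lt_div hx0).2 hxy
    nlinarith
  · have hlim := tendsto_lintegral_exp_riemannSumSq hpre hT (hx0.trans hxy) hy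
    filter_upwards [hlim.eventually_le_const (ENNReal.lt_add_right ENNReal.ofReal_ne_top
      one_ne_zero)] with n hn
    have hscale : ∀ r : ℝ, (y / x) ^ 2 * (x ^ 2 / (2 * T ^ 2) * r) = y ^ 2 / (2 * T ^ 2) * r :=
      fun r => by field_simp
    simpa only [hscale] using hn

end

theorem mainTheorem5 {Ω : Type*} [MeasurableSpace Ω] (P : Measure Ω) [IsProbabilityMeasure P]
    (W : ℝ≥0 → Ω → ℝ) (hW : IsBrownianReal W P) (T : ℝ) (hT : 0 ≤ T) :
    AEMeasurable (fun ω => Real.exp (∫ t in (0 : ℝ)..T, (W t.toNNReal ω) ^ 2)) P ∧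
    (T < Real.pi / (2 * Real.sqrt 2) →
      ∫⁻ ω, ENNReal.ofReal (Real.exp (∫ t in (0 : ℝ)..T, (W t.toNNReal ω) ^ 2)) ∂P
        = ENNReal.ofReal (1 / Real.sqrt (Real.cos (Real.sqrt 2 * T)))) ∧
    (Real.pi / (2 * Real.sqrt 2) ≤ T →
      ∫⁻ ω, ENNReal.ofReal (Real.exp (∫ t in (0 : ℝ)..T, (W t.toNNReal ω) ^ 2)) ∂P = ⊤) := by
  have h2 : 0 < √2 := by positivity
  refine ⟨?_, fun hlt => ?_, fun hle => ?_⟩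
  · exact (aemeasurable_of_tendsto_metrizable_ae' (aemeasurable_riemannSumSq
      hW.toIsPreBrownianReal T) (ae_tendsto_riemannSumSq hW hT)).exp
  · rcases hT.eq_or_lt with rfl | hT0
    · simp
    · have hx : √2 * T < Real.pi / 2 := by
        rw [lt_div_iff₀ (by positivity)] at hlt
        linarith
      have h := lintegral_exp_integral_sq hW hT0 (mul_pos h2 hT0) hx
      have hone : (√2 * T) ^ 2 / (2 * T ^ 2) = 1 := by
        rw [mul_pow, Real.sq_sqrt zero_le_two]
        exact div_self (by positivity)
      simpa only [hone, one_mul] using h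
  · have hT0 : 0 < T := lt_of_lt_of_le (by positivity) hle
    have hTx : Real.pi / 2 ≤ √2 * T := by
      rw [div_le_iff₀ (by positivity)] at hle
      linarith
    -- `1 / √(cos x)` is a lower bound for every `x < π / 2`, by monotonicity in the exponent
    have hlow : ∀ᶠ x in 𝓝[<] (Real.pi / 2), ENNReal.ofReal (1 / √(Real.cos x)) ≤
        ∫⁻ ω, ENNReal.ofReal (Real.exp (∫ t in (0 : ℝ)..T, (W t.toNNReal ω) ^ 2)) ∂P := by
      filter_upwards [Ioo_mem_nhdsLT Real.pi_div_two_pos] with x hx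
      rw [← lintegral_exp_integral_sq hW hT0 hx.1 hx.2]
      refine lintegral_mono fun ω => ENNReal.ofReal_le_ofReal (Real.exp_le_exp.2 ?_)
      refine mul_le_of_le_one_left
        (intervalIntegral.integral_nonneg hT fun t _ => sq_nonneg _) ?_
      rw [div_le_one (by positivity)]
      calc x ^ 2 ≤ (√2 * T) ^ 2 := pow_le_pow_left₀ hx.1.le (hx.2.le.trans hTx) 2
        _ = 2 * T ^ 2 := by rw [mul_pow, Real.sq_sqrt zero_le_two]
    have hcos : Tendsto (fun x => √(Real.cos x)) (𝓝[<] (Real.pi / 2)) (𝓝[>] 0) := by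
      refine tendsto_nhdsWithin_iff.2 ⟨?_, ?_⟩
      · have : Continuous fun x => √(Real.cos x) := Real.continuous_cos.sqrt
        simpa using (this.tendsto (Real.pi / 2)).mono_left nhdsWithin_le_nhds
      · filter_upwards [Ioo_mem_nhdsLT Real.pi_div_two_pos] with x hx
        exact Real.sqrt_pos.2 (Real.cos_pos_of_mem_Ioo ⟨by linarith [hx.1, Real.pi_pos], hx.2⟩)
    have htop : Tendsto (fun x => ENNReal.ofReal (1 / √(Real.cos x))) (𝓝[<] (Real.pi / 2))
        (𝓝 ⊤) := by
      simp only [one_div]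
      exact ENNReal.tendsto_ofReal_atTop.comp (tendsto_inv_nhdsGT_zero.comp hcos)
    exact top_le_iff.1 (le_of_tendsto htop hlow)
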